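/- All graphs are finite, undirected, simple and connected. For a graph $G=(V,E)$, a set $S\subseteq V$ is a dominating set if every vertex not in $S$ is adjacent to at least one vertex of $S$, and a perfect dominating set if every vertex not in $S$ is adjacent to exactly one vertex of $S$. Let $\Delta(G)$ be the maximum degree of $G$, and let $\gamma(G)$ and $\gamma_{11}(G)$ be the minimum cardinality of a dominating set and of a perfect dominating set of $G$, respectively. Theorem. Let $k,n$ be integers with $n\ge 6$ and $3\le k\le n$. Then there exists a connected graph $G$ of order $n$ with $\Delta(G)=n-3$, $\gamma(G)=3$ and $\gamma_{11}(G)=k$ if and only if $(k,n)\notin\{(4,6),(5,6),(6,6),(5,7),(6,7),(7,7),(8,8)\}$. -/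

import Mathlib

namespace SimpleGraph

variable {V : Type*} [Fintype V]

/-- `S` is a dominating set of `G`: every vertex outside `S` has a neighbour in `S`. -/
def IsDominatingSet (G : SimpleGraph V) (S : Finset V) : Prop :=
  ∀ v, v ∉ S → ∃ u ∈ S, G.Adj v u

/-- `S` is a perfect dominating set of `G`: every vertex outside `S` has exactly one neighbour
in `S`. -/
def IsPerfectDominatingSet (G : SimpleGraph V) (S : Finset V) : Prop :=
  ∀ v, v ∉ S → ∃! u, u ∈ S ∧ G.Adj v u

/-- The domination number `γ(G)`: the minimum cardinality of a dominating set. The minimum is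
over a nonempty set, see `isDominatingSet_univ`. -/
noncomputable def dominationNumber (G : SimpleGraph V) : ℕ :=
  sInf {m : ℕ | ∃ S : Finset V, G.IsDominatingSet S ∧ S.card = m}

/-- The perfect domination number `γ₁₁(G)`: the minimum cardinality of a perfect dominating set.
The minimum is over a nonempty set, see `isPerfectDominatingSet_univ`. -/
noncomputable def perfectDominationNumber (G : SimpleGraph V) : ℕ :=
  sInf {m : ℕ | ∃ S : Finset V, G.IsPerfectDominatingSet S ∧ S.card = m}

theorem isDominatingSet_univ (G : SimpleGraph V) : G.IsDominatingSet Finset.univ :=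
  fun v hv => absurd (Finset.mem_univ v) hv

theorem isPerfectDominatingSet_univ (G : SimpleGraph V) :
    G.IsPerfectDominatingSet Finset.univ :=
  fun v hv => absurd (Finset.mem_univ v) hv

end SimpleGraph

/-! Let `u` have degree `n - 3`, with non-neighbours `v` and `w`. If some `y` were equal or adjacent
to `v`, and equal or adjacent to `w`, then `{u, y}` would dominate. So `γ = 3` forces `v` and `w` to
be non-adjacent with disjoint neighbourhoods inside `N(u)`. Up to labelling, only the sizes of these
neighbourhoods and the edges inside `N(u)` remain free (`exists_normalAdj`). For `n = 6, 7, 8` a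
finite check over these data finds either a dominating pair, which is impossible, or a perfect
dominating set of at most 3, 4, 7 vertices respectively (`hasWitness_six`, `hasWitness_seven`,
`hasWitness_eight`).

For existence, the engine is propagation: if a perfect dominating set contains `u`, it contains
every neighbour of `u` that has a second neighbour in the set. Hence a path inside `N(u)` is
swallowed whole once one of its vertices is in, and its length tunes `γ₁₁`. This gives
`realizes_of_le_sub_three` and `realizes_of_eight_le`; the pairs (7, 9), (6, 8), (7, 8) left over
get explicit graphs. -/

namespace SimpleGraph

/-! ### Bounds for the two domination numbers -/

section Numbers

variable {V : Type*}

theorem dominationNumber_le {G : SimpleGraph V} {S : Finset V} (hS : G.IsDominatingSet S) :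
    G.dominationNumber ≤ S.card :=
  Nat.sInf_le ⟨S, hS, rfl⟩

theorem perfectDominationNumber_le {G : SimpleGraph V} {S : Finset V}
    (hS : G.IsPerfectDominatingSet S) : G.perfectDominationNumber ≤ S.card :=
  Nat.sInf_le ⟨S, hS, rfl⟩

theorem IsPerfectDominatingSet.isDominatingSet {G : SimpleGraph V} {S : Finset V}
    (hS : G.IsPerfectDominatingSet S) : G.IsDominatingSet S :=
  fun v hv => (hS v hv).exists

theorem perfectDominationNumber_eq {G : SimpleGraph V} {k : ℕ}
    (hS : ∃ S, G.IsPerfectDominatingSet S ∧ S.card = k)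
    (hmin : ∀ S, G.IsPerfectDominatingSet S → k ≤ S.card) : G.perfectDominationNumber = k := by
  apply le_antisymm (Nat.sInf_le hS)
  exact le_csInf ⟨k, hS⟩ fun m ⟨S, h, hm⟩ => hm ▸ hmin S h

theorem not_isDominatingSet_pair [DecidableEq V] {G : SimpleGraph V}
    (h : G.dominationNumber = 3) (x y : V) : ¬ G.IsDominatingSet {x, y} := fun hS => by
  have := dominationNumber_le hS
  have := Finset.card_le_two (a := x) (b := y)
  omega

theorem IsDominatingSet.mono {G : SimpleGraph V} {S T : Finset V} (hS : G.IsDominatingSet S)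
    (h : S ⊆ T) : G.IsDominatingSet T := fun v hv =>
  let ⟨u, hu, ha⟩ := hS v fun h' => hv (h h')
  ⟨u, h hu, ha⟩

theorem three_le_card_of_not_isDominatingSet_pair [DecidableEq V] [Nonempty V]
    {G : SimpleGraph V} (hpair : ∀ x y, ¬ G.IsDominatingSet {x, y}) {T : Finset V}
    (hT : G.IsDominatingSet T) : 3 ≤ T.card := by
  by_contra! hlt
  obtain ⟨x, y, hxy⟩ : ∃ x y, T ⊆ {x, y} := by
    have : T.card = 0 ∨ T.card = 1 ∨ T.card = 2 := by omega
    rcases this with h | h | h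
    · obtain ⟨x⟩ := ‹Nonempty V›
      exact ⟨x, x, by simp [Finset.card_eq_zero.1 h]⟩
    · obtain ⟨x, rfl⟩ := Finset.card_eq_one.1 h
      exact ⟨x, x, by simp⟩
    · obtain ⟨x, y, -, rfl⟩ := Finset.card_eq_two.1 h
      exact ⟨x, y, subset_rfl⟩
  exact hpair x y (hT.mono hxy)

theorem dominationNumber_eq_three [DecidableEq V] [Nonempty V] {G : SimpleGraph V} {S : Finset V}
    (hS : G.IsDominatingSet S) (hc : S.card = 3)
    (hpair : ∀ x y, ¬ G.IsDominatingSet {x, y}) : G.dominationNumber = 3 := by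
  apply le_antisymm (hc ▸ dominationNumber_le hS)
  refine le_csInf ⟨_, S, hS, rfl⟩ ?_
  rintro m ⟨T, hT, rfl⟩
  exact three_le_card_of_not_isDominatingSet_pair hpair hT

end Numbers

/-- A connected graph of order `n` with maximum degree `n - 3`, domination number `3` and
perfect domination number `k`. -/
def Realizes (k n : ℕ) : Prop :=
  ∃ (G : SimpleGraph (Fin n)) (_ : DecidableRel G.Adj),
    G.Connected ∧ G.maxDegree = n - 3 ∧ G.dominationNumber = 3 ∧ G.perfectDominationNumber = k

/-- The vertex `i` may itself be one of the three, being its own non-neighbour. -/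
theorem degree_le_of_three_not_adj {n : ℕ} {G : SimpleGraph (Fin n)} [DecidableRel G.Adj]
    {i x y z : Fin n} (hxy : x ≠ y) (hxz : x ≠ z) (hyz : y ≠ z) (hx : ¬ G.Adj i x)
    (hy : ¬ G.Adj i y) (hz : ¬ G.Adj i z) : G.degree i ≤ n - 3 := by
  have : G.neighborFinset i ⊆ ({x, y, z} : Finset (Fin n))ᶜ := by
    intro w hw
    rw [mem_neighborFinset] at hw
    simp only [Finset.mem_compl, Finset.mem_insert, Finset.mem_singleton]
    rintro (rfl | rfl | rfl) <;> contradiction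
  have h3 : ({x, y, z} : Finset (Fin n)).card = 3 := by
    rw [Finset.card_eq_three]; exact ⟨x, y, z, hxy, hxz, hyz, rfl⟩
  have := Finset.card_le_card this
  rwa [Finset.card_compl, h3, Fintype.card_fin, card_neighborFinset_eq_degree] at this

/-! ### Existence: a centre joined to a path -/

/-- The adjacency relation of `pathGraphWithCenter`. -/
def PathRel (q b b' c c' i j : ℕ) : Prop :=
  i ≠ j ∧ (((i = 0 ∧ 3 ≤ j) ∨ (i = 1 ∧ (j = b ∨ j = b')) ∨
    (i = 2 ∧ (j = c ∨ j = c')) ∨ (3 ≤ i ∧ j = i + 1 ∧ j < q)) ∨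
    ((j = 0 ∧ 3 ≤ i) ∨ (j = 1 ∧ (i = b ∨ i = b')) ∨
      (j = 2 ∧ (i = c ∨ i = c')) ∨ (3 ≤ j ∧ i = j + 1 ∧ i < q)))

/-- The graph on `Fin n` in which `0` is adjacent to all vertices `≥ 3`, `1` to `b` and `b'`,
`2` to `c` and `c'`, and the vertices from `3` to `q - 1` form a path. -/
def pathGraphWithCenter (n q b b' c c' : ℕ) : SimpleGraph (Fin n) where
  Adj i j := PathRel q b b' c c' i j
  symm := ⟨fun _ _ h => ⟨h.1.symm, h.2.symm⟩⟩
  loopless := ⟨fun _ h => h.1 rfl⟩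

instance (n q b b' c c' : ℕ) : DecidableRel (pathGraphWithCenter n q b b' c c').Adj :=
  fun i j => by
    change Decidable (PathRel q b b' c c' i j)
    unfold PathRel
    infer_instance

theorem adj_pathGraphWithCenter {n q b b' c c' : ℕ} {i j : Fin n} :
    (pathGraphWithCenter n q b b' c c').Adj i j ↔ PathRel q b b' c c' i j := Iff.rfl

/-- The vertex 0 misses only itself, 1 and 2, so it has degree `n - 3` and `{0, 1, 2}` dominates
whatever the parameters; connectedness only needs 1 and 2 to be attached at `b` and `c`. -/
theorem realizes_of_pathGraphWithCenter {n q b b' c c' k : ℕ} (hn : 6 ≤ n) (hb : 3 ≤ b)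
    (hbn : b < n) (hc : 3 ≤ c) (hcn : c < n)
    (hdeg : ∀ i : Fin n, (pathGraphWithCenter n q b b' c c').degree i ≤ n - 3)
    (hpair : ∀ x y, ¬ (pathGraphWithCenter n q b b' c c').IsDominatingSet {x, y})
    (hS : ∃ S, (pathGraphWithCenter n q b b' c c').IsPerfectDominatingSet S ∧ S.card = k)
    (hmin : ∀ S, (pathGraphWithCenter n q b b' c c').IsPerfectDominatingSet S → k ≤ S.card) :
    Realizes k n := by
  have : Nonempty (Fin n) := ⟨⟨0, by omega⟩⟩
  refine ⟨pathGraphWithCenter n q b b' c c', inferInstance, ?_, ?_, ?_,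
    perfectDominationNumber_eq hS hmin⟩
  · rw [connected_iff_exists_forall_reachable]
    refine ⟨⟨0, by omega⟩, fun w => ?_⟩
    have hA : ∀ {i j : ℕ} (hi : i < n) (hj : j < n), PathRel q b b' c c' i j →
        (pathGraphWithCenter n q b b' c c').Reachable ⟨i, hi⟩ ⟨j, hj⟩ := fun hi hj h =>
      Adj.reachable (adj_pathGraphWithCenter.2 h)
    have h3 : ∀ w : Fin n, 3 ≤ w.val →
        (pathGraphWithCenter n q b b' c c').Reachable ⟨0, by omega⟩ w := fun w hw =>
      hA _ _ (by unfold PathRel; omega)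
    by_cases h : 3 ≤ w.val
    · exact h3 w h
    by_cases h0 : w.val = 0
    · rw [show w = ⟨0, by omega⟩ from Fin.ext h0]
    by_cases h1 : w.val = 1
    · exact (h3 ⟨b, hbn⟩ hb).trans (hA _ _ (by unfold PathRel; omega))
    · exact (h3 ⟨c, hcn⟩ hc).trans (hA _ _ (by unfold PathRel; omega))
  · apply le_antisymm (maxDegree_le_of_forall_degree_le _ _ hdeg)
    refine le_trans ?_ (degree_le_maxDegree _ ⟨0, by omega⟩)
    have : ({⟨0, by omega⟩, ⟨1, by omega⟩, ⟨2, by omega⟩} : Finset (Fin n))ᶜ ⊆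
        (pathGraphWithCenter n q b b' c c').neighborFinset ⟨0, by omega⟩ := by
      intro w hw
      simp only [Finset.mem_compl, Finset.mem_insert, Finset.mem_singleton, Fin.ext_iff] at hw
      rw [mem_neighborFinset]
      change PathRel q b b' c c' 0 w
      unfold PathRel
      omega
    have h := Finset.card_le_card this
    rw [Finset.card_compl, Fintype.card_fin, card_neighborFinset_eq_degree] at h
    exact le_trans (Nat.sub_le_sub_left Finset.card_le_three n) h
  · refine dominationNumber_eq_three
      (S := {⟨0, by omega⟩, ⟨1, by omega⟩, ⟨2, by omega⟩}) ?_ ?_ hpair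
    · intro v hv
      refine ⟨⟨0, by omega⟩, by simp, ?_⟩
      simp only [Finset.mem_insert, Finset.mem_singleton, Fin.ext_iff] at hv
      change PathRel q b b' c c' v 0
      unfold PathRel
      omega
    · rw [Finset.card_eq_three]
      exact ⟨_, _, _, by simp, by simp, by simp, rfl⟩

section

variable {n q b b' c c' : ℕ}

/-- Vertex sets are pushed to `ℕ`, where `omega` can settle adjacency. -/
theorem exists_pathRel_of_isDominatingSet {S : Finset (Fin n)}
    (hS : (pathGraphWithCenter n q b b' c c').IsDominatingSet S) {i : ℕ} (hi : i < n)
    (hiS : i ∉ S.map Fin.valEmbedding) :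
    ∃ j ∈ S.map Fin.valEmbedding, PathRel q b b' c c' i j := by
  obtain ⟨u, hu, ha⟩ := hS ⟨i, hi⟩ fun h => hiS (Finset.mem_map.2 ⟨_, h, rfl⟩)
  exact ⟨u, Finset.mem_map.2 ⟨_, hu, rfl⟩, adj_pathGraphWithCenter.1 ha⟩

theorem eq_of_pathRel_of_isPerfectDominatingSet {S : Finset (Fin n)}
    (hS : (pathGraphWithCenter n q b b' c c').IsPerfectDominatingSet S) {i j l : ℕ} (hi : i < n)
    (hiS : i ∉ S.map Fin.valEmbedding) (hj : j ∈ S.map Fin.valEmbedding)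
    (hl : l ∈ S.map Fin.valEmbedding) (hij : PathRel q b b' c c' i j)
    (hil : PathRel q b b' c c' i l) : j = l := by
  obtain ⟨j, hj', rfl⟩ := Finset.mem_map.1 hj
  obtain ⟨l, hl', rfl⟩ := Finset.mem_map.1 hl
  have := (hS ⟨i, hi⟩ fun h => hiS (Finset.mem_map.2 ⟨_, h, rfl⟩)).unique
    ⟨hj', adj_pathGraphWithCenter.2 hij⟩ ⟨hl', adj_pathGraphWithCenter.2 hil⟩
  rw [this]

theorem isPerfectDominatingSet_of_pathRel {S : Finset (Fin n)}
    (h : ∀ i < n, i ∉ S.map Fin.valEmbedding → ∃ j ∈ S.map Fin.valEmbedding,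
      PathRel q b b' c c' i j ∧ ∀ l ∈ S.map Fin.valEmbedding, PathRel q b b' c c' i l → l = j) :
    (pathGraphWithCenter n q b b' c c').IsPerfectDominatingSet S := by
  intro v hv
  obtain ⟨j, hj, hr, hu⟩ := h v v.2 fun hm => by
    obtain ⟨x, hx, hxv⟩ := Finset.mem_map.1 hm
    exact hv (Fin.ext hxv ▸ hx)
  obtain ⟨j, hj', rfl⟩ := Finset.mem_map.1 hj
  exact ⟨j, ⟨hj', adj_pathGraphWithCenter.2 hr⟩, fun l hl => Fin.ext <|
    hu l (Finset.mem_map.2 ⟨l, hl.1, rfl⟩) (adj_pathGraphWithCenter.1 hl.2)⟩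

end

theorem degree_le_of_not_pathRel {n q b b' c c' : ℕ} {i : Fin n}
    (h : ∃ x y z, x < n ∧ y < n ∧ z < n ∧ x ≠ y ∧ x ≠ z ∧ y ≠ z ∧ ¬ PathRel q b b' c c' i x ∧
      ¬ PathRel q b b' c c' i y ∧ ¬ PathRel q b b' c c' i z) :
    (pathGraphWithCenter n q b b' c c').degree i ≤ n - 3 := by
  obtain ⟨x, y, z, hx, hy, hz, hxy, hxz, hyz, h1, h2, h3⟩ := h
  apply degree_le_of_three_not_adj (x := ⟨x, hx⟩) (y := ⟨y, hy⟩) (z := ⟨z, hz⟩)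
  · simpa using hxy
  · simpa using hxz
  · simpa using hyz
  all_goals rw [adj_pathGraphWithCenter]; assumption

theorem map_valEmbedding_filter {n : ℕ} (p : ℕ → Prop) [DecidablePred p] :
    (Finset.univ.filter fun i : Fin n => p i.val).map Fin.valEmbedding =
      (Finset.range n).filter p := by
  ext i
  simp only [Finset.mem_map, Finset.mem_filter, Finset.mem_univ, true_and, Fin.valEmbedding_apply,
    Finset.mem_range]
  exact ⟨fun ⟨a, ha, h⟩ => h ▸ ⟨a.2, ha⟩, fun ⟨h, hp⟩ => ⟨⟨i, h⟩, hp, rfl⟩⟩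

/-- Here 1 and 2 are leaves at 3 and 4, which forces 3 and 4 into a perfect dominating set
containing 0; propagation then forces the whole path `3, …, k + 1`. Together with 0 these are `k`
vertices, and they do form a perfect dominating set. -/
theorem realizes_of_le_sub_three {k n : ℕ} (hk : 3 ≤ k) (hkn : k + 3 ≤ n) : Realizes k n := by
  have hpair : ∀ x y, ¬ (pathGraphWithCenter n (k + 2) 3 3 4 4).IsDominatingSet {x, y} := by
    intro x y h
    have hx := x.2
    have hy := y.2
    have h' := fun i hi => exists_pathRel_of_isDominatingSet h (i := i) hi
    simp only [Finset.map_insert, Finset.map_singleton, Fin.valEmbedding_apply, Finset.mem_insert,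
      Finset.mem_singleton, exists_eq_or_imp, exists_eq_left, PathRel] at h'
    -- The closed neighbourhoods of 1, 2 and `n - 1`, a leaf at 0, are disjoint, so two vertices
    -- cannot meet all three.
    have h1 := h' 1 (by omega)
    have h2 := h' 2 (by omega)
    have h3 := h' (n - 1) (by omega)
    omega
  refine realizes_of_pathGraphWithCenter (q := k + 2) (b := 3) (b' := 3) (c := 4) (c' := 4)
    (by omega) (by omega) (by omega) (by omega) (by omega) ?_ hpair ?_ ?_
  · intro i
    apply degree_le_of_not_pathRel
    have := i.2
    by_cases h3 : i.val = 3
    · exact ⟨3, 2, n - 1, by unfold PathRel; omega⟩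
    by_cases h4 : i.val = 4
    · exact ⟨4, 1, n - 1, by unfold PathRel; omega⟩
    by_cases h5 : 5 ≤ i.val
    · exact ⟨i, 1, 2, by unfold PathRel; omega⟩
    · exact ⟨0, 1, 2, by unfold PathRel; omega⟩
  · refine ⟨Finset.univ.filter fun i : Fin n => i.val = 0 ∨ 3 ≤ i.val ∧ i.val < k + 2,
      isPerfectDominatingSet_of_pathRel ?_, ?_⟩
    · rw [map_valEmbedding_filter (fun i => i = 0 ∨ 3 ≤ i ∧ i < k + 2)]
      intro i hi
      simp only [Finset.mem_filter, Finset.mem_range, PathRel]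
      intro h
      by_cases h1 : i = 1
      · exact ⟨3, by omega, by omega, by omega⟩
      by_cases h2 : i = 2
      · exact ⟨4, by omega, by omega, by omega⟩
      · exact ⟨0, by omega, by omega, by omega⟩
    · rw [← Finset.card_map Fin.valEmbedding,
        map_valEmbedding_filter (fun i => i = 0 ∨ 3 ≤ i ∧ i < k + 2),
        show (Finset.range n).filter (fun i => i = 0 ∨ 3 ≤ i ∧ i < k + 2) =
          insert 0 (Finset.Ico 3 (k + 2)) by ext i; simp; omega]
      simp
      omega
  · intro S hS
    have hE := fun i hi => exists_pathRel_of_isDominatingSet hS.isDominatingSet (i := i) hi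
    have hU := fun i j l hi =>
      eq_of_pathRel_of_isPerfectDominatingSet hS (i := i) (j := j) (l := l) hi
    rw [← Finset.card_map Fin.valEmbedding]
    generalize hT : S.map Fin.valEmbedding = T at *
    -- For `k = 3` the vertex 5 is off the path and the argument below fails, but a dominating set
    -- has at least 3 vertices anyway.
    rcases hk.eq_or_lt with rfl | hk4
    · rw [← hT, Finset.card_map]
      have : Nonempty (Fin n) := ⟨⟨0, by omega⟩⟩
      exact three_le_card_of_not_isDominatingSet_pair hpair hS.isDominatingSet
    -- Without 0, exactly one vertex `a ≥ 3` is in `T`. Dominating 5 puts `a` on the path, whereas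
    -- dominating `n - 1` makes `a = n - 1`, which is off it.
    have h0 : 0 ∈ T := by
      by_contra h0
      obtain ⟨a, haT, ha⟩ := hE 0 (by omega) h0
      have ha' : ∀ j ∈ T, 3 ≤ j → j = a := fun j hj h3 =>
        hU 0 j a (by omega) h0 hj haT (by unfold PathRel; omega) ha
      have h5 : a = 4 ∨ a = 5 ∨ a = 6 ∧ 6 < k + 2 := by
        by_cases h : 5 ∈ T
        · have := ha' 5 h; omega
        · obtain ⟨j, hj, hr⟩ := hE 5 (by omega) h
          unfold PathRel at hr
          by_cases hj0 : j = 0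
          · exact absurd (hj0 ▸ hj) h0
          · have := ha' j hj; omega
      have hl : a = n - 1 := by
        by_cases h : n - 1 ∈ T
        · have := ha' _ h; omega
        · obtain ⟨j, hj, hr⟩ := hE (n - 1) (by omega) h
          unfold PathRel at hr
          by_cases hj0 : j = 0
          · exact absurd (hj0 ▸ hj) h0
          · omega
      omega
    -- If `t` is outside, its leaf `s` is either inside, giving `t` the two neighbours 0 and `s`, or
    -- undominated.
    have key : ∀ s t, (s = 1 ∧ t = 3) ∨ (s = 2 ∧ t = 4) → t ∈ T := by
      intro s t hst
      by_contra ht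
      by_cases hs : s ∈ T
      · have := hU t 0 s (by omega) ht h0 hs (by unfold PathRel; omega) (by unfold PathRel; omega)
        omega
      · obtain ⟨j, hj, hr⟩ := hE s (by omega) hs
        unfold PathRel at hr
        have : j = t := by omega
        exact ht (this ▸ hj)
    have hpath : ∀ j, 3 ≤ j → j < k + 2 → j ∈ T := by
      intro j hj
      induction j, hj using Nat.le_induction with
      | base => exact fun _ => key 1 3 (by omega)
      | succ j hj ih =>
        intro hlt'
        by_contra h
        have := hU (j + 1) 0 j (by omega) h h0 (ih (by omega)) (by unfold PathRel; omega)
          (by unfold PathRel; omega)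
        omega
    have hsub : insert 0 (Finset.Ico 3 (k + 2)) ⊆ T := by
      intro j hj
      rw [Finset.mem_insert, Finset.mem_Ico] at hj
      rcases hj with rfl | hj
      · exact h0
      · exact hpath j hj.1 hj.2
    refine le_trans ?_ (Finset.card_le_card hsub)
    simp
    omega

/-- Now 1 and 2 have two neighbours each on the path `3, …, k - 1`. Once the path is swallowed, they
are forced in as well, and only the leaves `k, …, n - 1` at 0 can stay out. -/
theorem realizes_of_eight_le {k n : ℕ} (hk : 8 ≤ k) (hkn : k ≤ n) (hn : 9 ≤ n) :
    Realizes k n := by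
  refine realizes_of_pathGraphWithCenter (q := k) (b := 3) (b' := 5) (c := 6) (c' := 7) (by omega)
    (by omega) (by omega) (by omega) (by omega) ?_ ?_ ?_ ?_
  · intro i
    apply degree_le_of_not_pathRel
    have := i.2
    by_cases h3 : i.val = 3 ∨ i.val = 5
    · exact ⟨i, 2, 8, by unfold PathRel; omega⟩
    by_cases h4 : i.val = 6 ∨ i.val = 7
    · exact ⟨i, 1, 3, by unfold PathRel; omega⟩
    by_cases h5 : 3 ≤ i.val
    · exact ⟨i, 1, 2, by unfold PathRel; omega⟩
    · exact ⟨0, 1, 2, by unfold PathRel; omega⟩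
  · intro x y h
    have hx := x.2
    have hy := y.2
    have h' := fun i hi => exists_pathRel_of_isDominatingSet h (i := i) hi
    simp only [Finset.map_insert, Finset.map_singleton, Fin.valEmbedding_apply, Finset.mem_insert,
      Finset.mem_singleton, exists_eq_or_imp, exists_eq_left, PathRel] at h'
    generalize x.val = x at *
    generalize y.val = y at *
    -- One vertex must serve 1 and the other 2. Dominating 8 then requires 7, dominating 4 requires
    -- 3 or 5, and whichever of 3 and 5 is not chosen stays undominated.
    have hx' : (x = 1 ∨ x = 3 ∨ x = 5) ∨ (y = 1 ∨ y = 3 ∨ y = 5) := by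
      have := h' 1 (by omega)
      omega
    have hy' : (x = 2 ∨ x = 6 ∨ x = 7) ∨ (y = 2 ∨ y = 6 ∨ y = 7) := by
      have := h' 2 (by omega)
      omega
    have h0 := h' 0 (by omega)
    have h3 := h' 3 (by omega)
    have h4 := h' 4 (by omega)
    have h5 := h' 5 (by omega)
    have h8 := h' 8 (by omega)
    clear h'
    rcases hx' with (rfl | rfl | rfl) | (rfl | rfl | rfl) <;>
    rcases hy' with (hy' | hy' | hy') | (hy' | hy' | hy') <;> omega
  · refine ⟨Finset.univ.filter fun i : Fin n => i.val < k,
      isPerfectDominatingSet_of_pathRel ?_, ?_⟩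
    · rw [map_valEmbedding_filter (fun i => i < k)]
      intro i hi
      simp only [Finset.mem_filter, Finset.mem_range, PathRel]
      intro h
      exact ⟨0, by omega, by omega, by omega⟩
    · rw [Fin.card_filter_val_lt, min_eq_right hkn]
  · intro S hS
    have hE := fun i hi => exists_pathRel_of_isDominatingSet hS.isDominatingSet (i := i) hi
    have hU := fun i j l hi =>
      eq_of_pathRel_of_isPerfectDominatingSet hS (i := i) (j := j) (l := l) hi
    rw [← Finset.card_map Fin.valEmbedding]
    generalize hT : S.map Fin.valEmbedding = T at *
    -- Without 0, a single vertex `a ≥ 3` would have to dominate both 4 and 8, which are too far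
    -- apart on the path.
    have h0 : 0 ∈ T := by
      by_contra h0
      obtain ⟨a, haT, ha⟩ := hE 0 (by omega) h0
      have ha' : ∀ j ∈ T, 3 ≤ j → j = a := fun j hj h3 =>
        hU 0 j a (by omega) h0 hj haT (by unfold PathRel; omega) ha
      have h4 : a = 3 ∨ a = 4 ∨ a = 5 := by
        by_cases h : 4 ∈ T
        · have := ha' 4 h; omega
        · obtain ⟨j, hj, hr⟩ := hE 4 (by omega) h
          unfold PathRel at hr
          by_cases hj0 : j = 0
          · exact absurd (hj0 ▸ hj) h0
          · have := ha' j hj; omega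
      have h8 : a = 7 ∨ a = 8 ∨ a = 9 := by
        by_cases h : 8 ∈ T
        · have := ha' 8 h; omega
        · obtain ⟨j, hj, hr⟩ := hE 8 (by omega) h
          unfold PathRel at hr
          by_cases hj0 : j = 0
          · exact absurd (hj0 ▸ hj) h0
          · have := ha' j hj; omega
      omega
    have hstep : ∀ i j, 3 ≤ i → 3 ≤ j → i < k → j < k → (j = i + 1 ∨ i = j + 1) →
        i ∈ T → j ∈ T := by
      intro i j hi hj hik hjk hij hiT
      by_contra h
      have := hU j 0 i (by omega) h h0 hiT (by unfold PathRel; omega) (by unfold PathRel; omega)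
      omega
    have hiff : ∀ j, 3 ≤ j → j < k → (j ∈ T ↔ 3 ∈ T) := by
      intro j hj
      induction j, hj using Nat.le_induction with
      | base => simp
      | succ j hj ih =>
        intro hlt'
        rw [← ih (by omega)]
        exact ⟨hstep _ _ (by omega) (by omega) (by omega) (by omega) (by omega),
          hstep _ _ (by omega) (by omega) (by omega) (by omega) (by omega)⟩
    -- If the path is avoided, 1 is either inside, giving 3 the two neighbours 0 and 1, or
    -- undominated.
    have h3 : 3 ∈ T := by
      by_contra h3
      have h5 : 5 ∉ T := by rwa [hiff 5 (by omega) (by omega)]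
      by_cases h1 : 1 ∈ T
      · have := hU 3 0 1 (by omega) h3 h0 h1 (by unfold PathRel; omega) (by unfold PathRel; omega)
        omega
      · obtain ⟨j, hj, hr⟩ := hE 1 (by omega) h1
        unfold PathRel at hr
        have : j = 3 ∨ j = 5 := by omega
        rcases this with rfl | rfl <;> contradiction
    have hpath : ∀ j, 3 ≤ j → j < k → j ∈ T := fun j hj hjk => (hiff j hj hjk).2 h3
    have h12 : ∀ s t u, (s = 1 ∧ t = 3 ∧ u = 5) ∨ (s = 2 ∧ t = 6 ∧ u = 7) → s ∈ T := by
      intro s t u hst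
      by_contra hs
      have := hU s t u (by omega) hs (hpath t (by omega) (by omega)) (hpath u (by omega) (by omega))
        (by unfold PathRel; omega) (by unfold PathRel; omega)
      omega
    have hsub : Finset.range k ⊆ T := by
      intro j hj
      rw [Finset.mem_range] at hj
      by_cases hj3 : 3 ≤ j
      · exact hpath j hj3 hj
      · have : j = 0 ∨ j = 1 ∨ j = 2 := by omega
        rcases this with rfl | rfl | rfl
        · exact h0
        · exact h12 1 3 5 (by omega)
        · exact h12 2 6 7 (by omega)
    simpa using Finset.card_le_card hsub

/-! ### Existence: the three sporadic pairs -/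

/-- The graph on `Fin n` with the edges in the list `E`. -/
def ofEdgeList (n : ℕ) (E : List (ℕ × ℕ)) : SimpleGraph (Fin n) :=
  fromRel fun i j => (i.val, j.val) ∈ E

instance (n : ℕ) (E : List (ℕ × ℕ)) : DecidableRel (ofEdgeList n E).Adj := by
  unfold ofEdgeList
  infer_instance

instance {n : ℕ} (G : SimpleGraph (Fin n)) [DecidableRel G.Adj] (S : Finset (Fin n)) :
    Decidable (G.IsDominatingSet S) := by
  unfold IsDominatingSet
  infer_instance

instance {n : ℕ} (G : SimpleGraph (Fin n)) [DecidableRel G.Adj] (S : Finset (Fin n)) :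
    Decidable (G.IsPerfectDominatingSet S) := by
  unfold IsPerfectDominatingSet ExistsUnique
  infer_instance

/-- This is again a centre with a path, now `3, 4, 5, 6`, the neighbours of 1 and 2 alternating
along it; the omitted vertices 7 and 8 are leaves at 0. -/
theorem realizes_seven_nine : Realizes 7 9 := by
  refine ⟨ofEdgeList 9 [(0, 3), (0, 4), (0, 5), (0, 6), (0, 7), (0, 8), (1, 3), (1, 5), (2, 4),
    (2, 6), (3, 4), (4, 5), (5, 6)], inferInstance, by decide +kernel, by decide +kernel,
    dominationNumber_eq_three (S := {0, 1, 2}) (by decide +kernel) rfl (by decide +kernel),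
    perfectDominationNumber_eq ⟨{7, 8}ᶜ, by decide +kernel, rfl⟩ (by decide +kernel)⟩

theorem realizes_six_eight : Realizes 6 8 := by
  refine ⟨ofEdgeList 8 [(0, 3), (0, 4), (0, 5), (0, 6), (0, 7), (1, 3), (1, 4), (2, 5), (3, 4),
    (3, 6)], inferInstance, by decide +kernel, by decide +kernel,
    dominationNumber_eq_three (S := {0, 1, 2}) (by decide +kernel) rfl (by decide +kernel),
    perfectDominationNumber_eq ⟨{2, 7}ᶜ, by decide +kernel, rfl⟩ (by decide +kernel)⟩

theorem realizes_seven_eight : Realizes 7 8 := by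
  refine ⟨ofEdgeList 8 [(0, 3), (0, 4), (0, 5), (0, 6), (0, 7), (1, 3), (1, 4), (1, 5), (2, 6),
    (3, 4), (3, 6), (3, 7)], inferInstance, by decide +kernel, by decide +kernel,
    dominationNumber_eq_three (S := {0, 1, 2}) (by decide +kernel) rfl (by decide +kernel),
    perfectDominationNumber_eq ⟨{2}ᶜ, by decide +kernel, rfl⟩ (by decide +kernel)⟩

/-! ### Non-existence: finite check of normal forms -/

/-- The adjacency of a graph in normal form: `0` is adjacent to all vertices `≥ 3`, `1` to those
in `[3, s)`, `2` to those in `[s, t)`, and two vertices `3 ≤ i < j` are adjacent if `e i j`. -/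
def normalAdj (s t : ℕ) (e : ℕ → ℕ → Bool) (i j : ℕ) : Bool :=
  let h := fun i j => if i = 0 then decide (3 ≤ j) else if i = 1 then decide (3 ≤ j ∧ j < s) else
    if i = 2 then decide (s ≤ j ∧ j < t) else e i j
  if i < j then h i j else if j < i then h j i else false

/-- Exactly one entry of a list is `true`. -/
def exactlyOne : List Bool → Bool
  | [] => false
  | b :: l => if b then l.all not else exactlyOne l

/-- The list `L` dominates the graph on `0, …, n - 1` with adjacency `a`. -/
def dominatingCheck (n : ℕ) (a : ℕ → ℕ → Bool) (L : List ℕ) : Bool :=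
  (List.range n).all fun i => decide (i ∈ L) || L.any (a i)

/-- The list `L` perfectly dominates the graph on `0, …, n - 1` with adjacency `a`. -/
def perfectCheck (n : ℕ) (a : ℕ → ℕ → Bool) (L : List ℕ) : Bool :=
  (List.range n).all fun i => decide (i ∈ L) || exactlyOne (L.map (a i))

/-- Some list of two vertices dominates, or some list of at most `K` vertices perfectly
dominates. -/
def HasWitness (n K : ℕ) (a : ℕ → ℕ → Bool) : Prop :=
  (∃ L, L.length ≤ 2 ∧ (∀ x ∈ L, x < n) ∧ dominatingCheck n a L = true) ∨
    ∃ L, L.length ≤ K ∧ (∀ x ∈ L, x < n) ∧ perfectCheck n a L = true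

theorem hasWitness_of_any {n K : ℕ} {a : ℕ → ℕ → Bool} (D P : List (List ℕ))
    (hD : ∀ L ∈ D, L.length ≤ 2 ∧ ∀ x ∈ L, x < n) (hP : ∀ L ∈ P, L.length ≤ K ∧ ∀ x ∈ L, x < n)
    (h : (D.any (dominatingCheck n a) || P.any (perfectCheck n a)) = true) :
    HasWitness n K a := by
  rw [Bool.or_eq_true, List.any_eq_true, List.any_eq_true] at h
  rcases h with ⟨L, hL, h⟩ | ⟨L, hL, h⟩
  · exact Or.inl ⟨L, (hD L hL).1, (hD L hL).2, h⟩
  · exact Or.inr ⟨L, (hP L hL).1, (hP L hL).2, h⟩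

theorem hasWitness_six {s t : ℕ} (e : ℕ → ℕ → Bool) (hs : 3 < s) (hst : s < t) (ht : t ≤ 6) :
    HasWitness 6 3 (normalAdj s t e) := by
  have hs' : s < 6 := by omega
  interval_cases s <;> interval_cases t
  on_goal 1 =>
    refine hasWitness_of_any [[3, 4]] [[0, 3, 4]] (by decide) (by decide) ?_
  on_goal 2 =>
    refine hasWitness_of_any [[2, 3]] [] (by decide) (by decide) ?_
  on_goal 3 =>
    refine hasWitness_of_any [[1, 5]] [] (by decide) (by decide) ?_
  -- What is left is a propositional tautology in the unknown bits `e i j`.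
  all_goals
    simp only [List.any_cons, List.any_nil, dominatingCheck, perfectCheck, List.range_succ,
      List.range_zero, List.all_cons, List.all_nil, List.all_append, List.map_cons, List.map_nil,
      exactlyOne, List.mem_cons, List.not_mem_nil, List.nil_append]
    simp +decide [normalAdj]
    try grind (splits := 40)

theorem hasWitness_seven {s t : ℕ} (e : ℕ → ℕ → Bool) (hs : 3 < s) (hst : s < t) (ht : t ≤ 7) :
    HasWitness 7 4 (normalAdj s t e) := by
  have hs' : s < 7 := by omega
  interval_cases s <;> interval_cases t
  on_goal 1 =>
    refine hasWitness_of_any [[3, 4]] [[0, 3, 4, 5], [0, 3, 4, 6], [1, 2, 5], [1, 2, 6]] (by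
      decide) (by decide) ?_
  on_goal 2 =>
    refine hasWitness_of_any [[2, 3], [3, 4], [3, 5]] [[0, 3, 4, 6], [0, 3, 5, 6], [1, 2, 4], [1,
      2, 6]] (by decide) (by decide) ?_
  on_goal 3 =>
    refine hasWitness_of_any [[2, 3]] [] (by decide) (by decide) ?_
  on_goal 4 =>
    refine hasWitness_of_any [[3, 5], [4, 5]] [[0, 3, 5, 6], [0, 4, 5, 6], [1, 2, 3], [1, 2, 6]]
      (by decide) (by decide) ?_
  on_goal 5 =>
    refine hasWitness_of_any [[2, 3], [3, 5], [3, 6]] [[1, 2, 3], [1, 2, 4], [1, 2, 5], [1, 2, 6]]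
      (by decide) (by decide) ?_
  on_goal 6 =>
    refine hasWitness_of_any [[1, 6]] [] (by decide) (by decide) ?_
  all_goals
    simp only [List.any_cons, List.any_nil, dominatingCheck, perfectCheck, List.range_succ,
      List.range_zero, List.all_cons, List.all_nil, List.all_append, List.map_cons, List.map_nil,
      exactlyOne, List.mem_cons, List.not_mem_nil, List.nil_append]
    simp +decide [normalAdj]
    try grind (splits := 40)

theorem hasWitness_eight {s t : ℕ} (e : ℕ → ℕ → Bool) (hs : 3 < s) (hst : s < t) (ht : t ≤ 8) :
    HasWitness 8 7 (normalAdj s t e) := by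
  have hs' : s < 8 := by omega
  -- If 1 or 2 is a leaf, the complement of one leaf or of both is perfect dominating; for `(s, t) =
  -- (4, 8)` and `(7, 8)` a dominating pair is used instead. Only (5, 7), (5, 8) and (6, 8) depend
  -- on the edges `e`.
  interval_cases s <;> interval_cases t
  on_goal 1 =>
    refine hasWitness_of_any [] [[0, 3, 4, 5, 6, 7]] (by decide) (by decide) ?_
  on_goal 2 =>
    refine hasWitness_of_any [] [[0, 2, 3, 4, 5, 6, 7]] (by decide) (by decide) ?_
  on_goal 3 =>
    refine hasWitness_of_any [] [[0, 2, 3, 4, 5, 6, 7]] (by decide) (by decide) ?_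
  on_goal 4 =>
    refine hasWitness_of_any [[2, 3]] [] (by decide) (by decide) ?_
  on_goal 5 =>
    refine hasWitness_of_any [] [[0, 1, 3, 4, 5, 6, 7]] (by decide) (by decide) ?_
  on_goal 6 =>
    refine hasWitness_of_any [[1, 5], [1, 6], [2, 3], [2, 4], [3, 5], [3, 6], [4, 5], [4, 6]] [[0,
      1, 3, 4, 5, 7], [0, 1, 3, 4, 6, 7], [0, 2, 3, 5, 6, 7], [0, 2, 4, 5, 6, 7], [1, 2, 3], [1, 2,
      4], [1, 2, 5], [1, 2, 6], [1, 2, 7]] (by decide) (by decide) ?_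
  on_goal 7 =>
    refine hasWitness_of_any [[1, 5], [1, 6], [1, 7], [2, 3], [3, 5], [3, 6], [3, 7], [4, 5], [4,
      6], [4, 7]] [[0, 1, 3, 4, 5], [0, 1, 3, 4, 6], [0, 1, 3, 4, 7], [0, 2, 3, 5, 6, 7], [0, 2, 4,
      5, 6, 7], [1, 2, 5], [1, 2, 6], [1, 2, 7]] (by decide) (by decide) ?_
  on_goal 8 =>
    refine hasWitness_of_any [] [[0, 1, 3, 4, 5, 6, 7]] (by decide) (by decide) ?_
  on_goal 9 =>
    refine hasWitness_of_any [[1, 6], [2, 3], [2, 4], [2, 5], [3, 6], [3, 7], [4, 6], [4, 7], [5,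
      6], [5, 7]] [[0, 2, 3, 6, 7], [0, 2, 4, 6, 7], [0, 2, 5, 6, 7], [1, 2, 3], [1, 2, 4], [1, 2,
      5], [1, 2, 6], [1, 2, 7]] (by decide) (by decide) ?_
  on_goal 10 =>
    refine hasWitness_of_any [[1, 7]] [] (by decide) (by decide) ?_
  all_goals
    simp only [List.any_cons, List.any_nil, dominatingCheck, perfectCheck, List.range_succ,
      List.range_zero, List.all_cons, List.all_nil, List.all_append, List.map_cons, List.map_nil,
      exactlyOne, List.mem_cons, List.not_mem_nil, List.nil_append]
    simp +decide [normalAdj]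
    try grind (splits := 40)

theorem exactlyOne_spec {l : List ℕ} {p : ℕ → Bool} (h : exactlyOne (l.map p) = true) :
    ∃ x ∈ l, p x = true ∧ ∀ y ∈ l, p y = true → y = x := by
  induction l with
  | nil => simp [exactlyOne] at h
  | cons a l ih =>
    rw [List.map_cons, exactlyOne] at h
    by_cases ha : p a = true
    · refine ⟨a, List.mem_cons_self, ha, fun y hy hp => ?_⟩
      rcases List.mem_cons.1 hy with rfl | hy
      · rfl
      · simp only [ha, if_true, List.all_map, List.all_eq_true, Function.comp] at h
        have := h y hy
        simp [hp] at this
    · rw [if_neg ha] at h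
      obtain ⟨x, hx, hpx, hu⟩ := ih h
      refine ⟨x, List.mem_cons_of_mem _ hx, hpx, fun y hy hp => ?_⟩
      rcases List.mem_cons.1 hy with rfl | hy
      · exact absurd hp ha
      · exact hu y hy hp

/-! ### Transport of witnesses along a labelling -/

section Transport

variable {n : ℕ} {G : SimpleGraph (Fin n)} {a : ℕ → ℕ → Bool}

/-- The vertices with labels in the list `L`. -/
def labelled (f : Equiv.Perm (Fin n)) (L : List ℕ) : Finset (Fin n) :=
  Finset.univ.filter fun x => (f.symm x).val ∈ L

theorem card_labelled_le (f : Equiv.Perm (Fin n)) (L : List ℕ) :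
    (labelled f L).card ≤ L.length := by
  refine le_trans ?_ (List.toFinset_card_le L)
  refine Finset.card_le_card_of_injOn (fun x => (f.symm x).val) ?_ ?_
  · intro x hx
    simpa [labelled] using hx
  · intro x _ y _ h
    exact f.symm.injective (Fin.ext h)

theorem dominationNumber_le_of_dominatingCheck (f : Equiv.Perm (Fin n))
    (hf : ∀ i j, G.Adj (f i) (f j) ↔ a i j = true) {L : List ℕ} (hL : ∀ x ∈ L, x < n)
    (h : dominatingCheck n a L = true) :
    G.dominationNumber ≤ L.length := by
  refine (dominationNumber_le (S := labelled f L) ?_).trans (card_labelled_le f L)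
  intro v hv
  obtain ⟨i, rfl⟩ := f.surjective v
  simp only [dominatingCheck, List.all_eq_true, List.mem_range] at h
  have := h i i.2
  simp only [labelled, Finset.mem_filter, Finset.mem_univ, true_and, Equiv.symm_apply_apply] at hv
  simp only [hv, decide_false, Bool.false_or, List.any_eq_true] at this
  obtain ⟨x, hx, ha⟩ := this
  exact ⟨f ⟨x, hL x hx⟩, by simpa [labelled] using hx, (hf _ _).2 ha⟩

theorem perfectDominationNumber_le_of_perfectCheck (f : Equiv.Perm (Fin n))
    (hf : ∀ i j, G.Adj (f i) (f j) ↔ a i j = true) {L : List ℕ} (hL : ∀ x ∈ L, x < n)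
    (h : perfectCheck n a L = true) :
    G.perfectDominationNumber ≤ L.length := by
  refine (perfectDominationNumber_le (S := labelled f L) ?_).trans (card_labelled_le f L)
  intro v hv
  obtain ⟨i, rfl⟩ := f.surjective v
  simp only [perfectCheck, List.all_eq_true, List.mem_range] at h
  have := h i i.2
  simp only [labelled, Finset.mem_filter, Finset.mem_univ, true_and, Equiv.symm_apply_apply] at hv
  simp only [hv, decide_false, Bool.false_or] at this
  obtain ⟨x, hx, ha, hu⟩ := exactlyOne_spec this
  refine ⟨f ⟨x, hL x hx⟩, ⟨by simpa [labelled] using hx, (hf _ _).2 ha⟩, ?_⟩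
  rintro y ⟨hy, hay⟩
  obtain ⟨j, rfl⟩ := f.surjective y
  have := hu j (by simpa [labelled] using hy) ((hf _ _).1 hay)
  rw [show j = ⟨x, hL x hx⟩ from Fin.ext this]

end Transport

/-! ### Reduction to normal form -/

theorem exists_le_iff_lt_of_monotone {n : ℕ} {c : Fin n → ℕ} (hc : Monotone c) (K : ℕ) :
    ∃ s ≤ n, ∀ i, c i ≤ K ↔ i.val < s := by
  have hex : ∃ s, ∀ i : Fin n, s ≤ i.val → K < c i := ⟨n, fun i hi => absurd i.2 (by omega)⟩
  classical
  refine ⟨Nat.find hex, Nat.find_min' hex fun i hi => absurd i.2 (by omega), fun i => ?_⟩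
  constructor
  · intro h
    by_contra! hlt
    exact absurd (Nat.find_spec hex i hlt) (by omega)
  · intro h
    by_contra! hlt
    refine Nat.find_min hex h fun j hj => hlt.trans_le (hc hj)

theorem exists_normalAdj {n : ℕ} (hn : 6 ≤ n) {G : SimpleGraph (Fin n)} [DecidableRel G.Adj]
    (hG : G.Connected) (hdeg : G.maxDegree = n - 3) (hdom : G.dominationNumber = 3) :
    ∃ (f : Equiv.Perm (Fin n)) (s t : ℕ) (e : ℕ → ℕ → Bool), 3 < s ∧ s < t ∧ t ≤ n ∧
      ∀ i j, G.Adj (f i) (f j) ↔ normalAdj s t e i j = true := by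
  classical
  have : Nonempty (Fin n) := ⟨⟨0, by omega⟩⟩
  have : Nontrivial (Fin n) := ⟨⟨0, by omega⟩, ⟨1, by omega⟩, by simp⟩
  obtain ⟨u, hu⟩ := G.exists_maximal_degree_vertex
  have hcard : ((insert u (G.neighborFinset u))ᶜ).card = 2 := by
    rw [Finset.card_compl, Finset.card_insert_of_notMem (by simp), card_neighborFinset_eq_degree,
      Fintype.card_fin]
    omega
  obtain ⟨v, w, hvw, hset⟩ := Finset.card_eq_two.1 hcard
  have hmem : ∀ x, (x ≠ u ∧ ¬ G.Adj u x) ↔ (x = v ∨ x = w) := by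
    intro x
    have := Finset.ext_iff.1 hset x
    simpa using this
  obtain ⟨hvu, huv⟩ := (hmem v).2 (Or.inl rfl)
  obtain ⟨hwu, huw⟩ := (hmem w).2 (Or.inr rfl)
  have hpair := not_isDominatingSet_pair hdom
  have hdominates : ∀ y, (v ≠ y → G.Adj v y) → (w ≠ y → G.Adj w y) → False := by
    intro y hv hw
    apply hpair u y
    intro x hx
    simp only [Finset.mem_insert, Finset.mem_singleton, not_or] at hx
    by_cases hux : G.Adj u x
    · exact ⟨u, by simp, hux.symm⟩
    · rcases (hmem x).1 ⟨hx.1, hux⟩ with rfl | rfl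
      · exact ⟨y, by simp, hv hx.2⟩
      · exact ⟨y, by simp, hw hx.2⟩
  have hnvw : ¬ G.Adj v w := fun h => hdominates v (fun h' => absurd rfl h') fun _ => h.symm
  have hcommon : ∀ y, G.Adj v y → ¬ G.Adj w y := fun y hv hw =>
    hdominates y (fun _ => hv) fun _ => hw
  have hpos : ∀ x, 0 < G.degree x := fun x =>
    hG.preconnected.minDegree_pos_of_nontrivial.trans_le (G.minDegree_le_degree x)
  obtain ⟨b, hb⟩ := (G.degree_pos_iff_exists_adj v).1 (hpos v)
  obtain ⟨c, hc⟩ := (G.degree_pos_iff_exists_adj w).1 (hpos w)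
  -- Sorting by this colour puts `u, v, w` at 0, 1, 2, then `N(v)`, then `N(w)`, then the rest; `s`
  -- and `t` are where colours 3 and 4 end.
  set col : Fin n → ℕ := fun x => if x = u then 0 else if x = v then 1 else if x = w then 2 else
    if G.Adj v x then 3 else if G.Adj w x then 4 else 5 with hcol
  set f := Tuple.sort col with hf
  have hmono : Monotone (col ∘ f) := Tuple.monotone_sort col
  obtain ⟨s, -, hs⟩ := exists_le_iff_lt_of_monotone hmono 3
  obtain ⟨t, htn, ht⟩ := exists_le_iff_lt_of_monotone hmono 4
  have hcu : ∀ x, col x ≤ 0 → x = u := fun x hx => by grind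
  have hcv : ∀ x, col x ≤ 1 → x = u ∨ x = v := fun x hx => by grind
  have hcw : ∀ x, col x ≤ 2 → x = u ∨ x = v ∨ x = w := fun x hx => by grind
  have hmono' : ∀ i j : Fin n, i.val ≤ j.val → col (f i) ≤ col (f j) := fun i j h => hmono h
  have h0 : f ⟨0, by omega⟩ = u := by
    obtain ⟨i, hi⟩ := f.surjective u
    apply hcu
    refine (hmono' _ i (Nat.zero_le _)).trans ?_
    simp [hi, hcol]
  have h1 : f ⟨1, by omega⟩ = v := by
    obtain ⟨i, hi⟩ := f.surjective v
    have hi0 : i.val ≠ 0 := fun h => hvu (by rw [← hi, ← h0]; congr 1; exact Fin.ext h)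
    refine (hcv _ ?_).resolve_left fun h => ?_
    · refine (hmono' _ i (Nat.one_le_iff_ne_zero.2 hi0)).trans ?_
      simp [hi, hcol, hvu]
    · simpa using f.injective (h.trans h0.symm)
  have h2 : f ⟨2, by omega⟩ = w := by
    obtain ⟨i, hi⟩ := f.surjective w
    have hi0 : i.val ≠ 0 := fun h => hwu (by rw [← hi, ← h0]; congr 1; exact Fin.ext h)
    have hi1 : i.val ≠ 1 := fun h => hvw (by rw [← hi, ← h1]; congr 1; exact Fin.ext h.symm)
    refine ((hcw _ ?_).resolve_left fun h => ?_).resolve_left fun h => ?_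
    · refine (hmono' _ i (by simp only; omega)).trans ?_
      simp [hi, hcol, hwu, hvw.symm]
    · simpa using f.injective (h.trans h0.symm)
    · simpa using f.injective (h.trans h1.symm)
  have hge : ∀ i : Fin n, 3 ≤ i.val ↔ f i ≠ u ∧ f i ≠ v ∧ f i ≠ w := by
    intro i
    rw [← h0, ← h1, ← h2, f.injective.ne_iff, f.injective.ne_iff, f.injective.ne_iff]
    simp only [ne_eq, Fin.ext_iff]
    omega
  have hAu : ∀ i : Fin n, G.Adj u (f i) ↔ 3 ≤ i.val := by
    intro i
    rw [hge]
    have := hmem (f i)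
    constructor
    · intro h
      exact ⟨h.ne', fun h' => huv (h' ▸ h), fun h' => huw (h' ▸ h)⟩
    · rintro ⟨h1, h2, h3⟩
      by_contra h
      rcases this.1 ⟨h1, h⟩ with h | h <;> contradiction
  have hAv : ∀ i : Fin n, G.Adj v (f i) ↔ 3 ≤ i.val ∧ i.val < s := by
    intro i
    rw [← hs, hge]
    constructor
    · intro h
      have hne : f i ≠ u ∧ f i ≠ v ∧ f i ≠ w :=
        ⟨fun h' => huv (h' ▸ h.symm), h.ne', fun h' => hnvw (h' ▸ h)⟩
      exact ⟨hne, by simp [hcol, hne, h]⟩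
    · rintro ⟨⟨h1, h2, h3⟩, h⟩
      by_contra hn
      simp only [hcol, Function.comp, h1, h2, h3, hn, if_false] at h
      split_ifs at h <;> omega
  have hAw : ∀ i : Fin n, G.Adj w (f i) ↔ s ≤ i.val ∧ i.val < t := by
    intro i
    rw [← ht, ← not_lt, ← hs]
    constructor
    · intro h
      have hne : f i ≠ u ∧ f i ≠ v ∧ f i ≠ w :=
        ⟨fun h' => huw (h' ▸ h.symm), fun h' => hnvw (h' ▸ h.symm), h.ne'⟩
      have hn : ¬ G.Adj v (f i) := fun h' => hcommon _ h' h
      simp [hcol, hne, hn, h]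
    · rintro ⟨h3, h⟩
      by_contra hn
      simp only [hcol, Function.comp] at h3 h
      split_ifs at h3 h <;> omega
  have hs3 : 3 < s := by
    obtain ⟨i, rfl⟩ := f.surjective b
    have := (hAv i).1 hb
    omega
  have hst : s < t := by
    obtain ⟨i, rfl⟩ := f.surjective c
    have := (hAw i).1 hc
    omega
  -- The value `false` outside the range is never consulted.
  refine ⟨f, s, t, fun i j => if h : i < n ∧ j < n then decide (G.Adj (f ⟨i, h.1⟩) (f ⟨j, h.2⟩))
    else false, hs3, hst, htn, ?_⟩
  have hlt : ∀ i j : Fin n, i.val < j.val → (G.Adj (f i) (f j) ↔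
      (if i.val = 0 then decide (3 ≤ j.val) else if i.val = 1 then decide (3 ≤ j.val ∧ j.val < s)
        else if i.val = 2 then decide (s ≤ j.val ∧ j.val < t) else decide (G.Adj (f i) (f j))) =
          true) := by
    intro i j hij
    split_ifs with hi0 hi1 hi2
    · rw [show i = ⟨0, by omega⟩ from Fin.ext hi0, h0, hAu, decide_eq_true_iff]
    · rw [show i = ⟨1, by omega⟩ from Fin.ext hi1, h1, hAv, decide_eq_true_iff]
    · rw [show i = ⟨2, by omega⟩ from Fin.ext hi2, h2, hAw, decide_eq_true_iff]
    · rw [decide_eq_true_iff]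
  intro i j
  simp only [normalAdj, i.2, j.2, and_self, dite_true, Fin.eta]
  rcases lt_trichotomy i.val j.val with h | h | h
  · rw [if_pos h]
    exact hlt i j h
  · rw [if_neg (by omega), if_neg (by omega), Fin.ext h]
    simp
  · rw [if_neg (by omega), if_pos h, G.adj_comm]
    exact hlt j i h

/-- A dominating list of at most two vertices contradicts `γ = 3`, so the witness must be the
perfect one. -/
theorem perfectDominationNumber_le_of_hasWitness {n K : ℕ} (hn : 6 ≤ n)
    (hK : ∀ (s t : ℕ) (e : ℕ → ℕ → Bool), 3 < s → s < t → t ≤ n → HasWitness n K (normalAdj s t e))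
    {G : SimpleGraph (Fin n)} [DecidableRel G.Adj] (hG : G.Connected)
    (hdeg : G.maxDegree = n - 3) (hdom : G.dominationNumber = 3) :
    G.perfectDominationNumber ≤ K := by
  obtain ⟨f, s, t, e, hs, hst, ht, hf⟩ := exists_normalAdj hn hG hdeg hdom
  rcases hK s t e hs hst ht with ⟨L, hlen, hL, h⟩ | ⟨L, hlen, hL, h⟩
  · have := dominationNumber_le_of_dominatingCheck f hf hL h
    omega
  · exact (perfectDominationNumber_le_of_perfectCheck f hf hL h).trans hlen

end SimpleGraph

/-! ### The characterization -/

theorem mainTheorem6 (k n : ℕ) (hk : 3 ≤ k) (hkn : k ≤ n) (hn : 6 ≤ n) :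
    (∃ (G : SimpleGraph (Fin n)) (_ : DecidableRel G.Adj),
      G.Connected ∧ G.maxDegree = n - 3 ∧ G.dominationNumber = 3 ∧
        G.perfectDominationNumber = k) ↔
    (k, n) ∉ ({(4, 6), (5, 6), (6, 6), (5, 7), (6, 7), (7, 7), (8, 8)} : Set (ℕ × ℕ)) := by
  simp only [Set.mem_insert_iff, Set.mem_singleton_iff, Prod.mk.injEq]
  constructor
  · rintro ⟨G, _, hG, hdeg, hdom, rfl⟩ hmem
    have h6 : n = 6 → G.perfectDominationNumber ≤ 3 := by
      rintro rfl
      exact SimpleGraph.perfectDominationNumber_le_of_hasWitness hn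
        (fun _ _ e => SimpleGraph.hasWitness_six e) hG hdeg hdom
    have h7 : n = 7 → G.perfectDominationNumber ≤ 4 := by
      rintro rfl
      exact SimpleGraph.perfectDominationNumber_le_of_hasWitness hn
        (fun _ _ e => SimpleGraph.hasWitness_seven e) hG hdeg hdom
    have h8 : n = 8 → G.perfectDominationNumber ≤ 7 := by
      rintro rfl
      exact SimpleGraph.perfectDominationNumber_le_of_hasWitness hn
        (fun _ _ e => SimpleGraph.hasWitness_eight e) hG hdeg hdom
    omega
  · intro hmem
    change SimpleGraph.Realizes k n
    by_cases h3 : k + 3 ≤ n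
    · exact SimpleGraph.realizes_of_le_sub_three hk h3
    by_cases h9 : 8 ≤ k ∧ 9 ≤ n
    · exact SimpleGraph.realizes_of_eight_le h9.1 hkn h9.2
    have : (k = 7 ∧ n = 9) ∨ (k = 6 ∧ n = 8) ∨ (k = 7 ∧ n = 8) := by omega
    rcases this with ⟨rfl, rfl⟩ | ⟨rfl, rfl⟩ | ⟨rfl, rfl⟩
    · exact SimpleGraph.realizes_seven_nine
    · exact SimpleGraph.realizes_six_eight
    · exact SimpleGraph.realizes_seven_eight
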